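/- \textbf{Model.} There are $n\ge 3$ candidates; candidate $i\in[n]$ has utility $\rho_i\ge 0$ for a receiver and $\xi_i\ge 0$ for a sender, where the $\rho_i$ are pairwise distinct and the $\xi_i$ are pairwise distinct. Let $c_R=\arg\max_i\rho_i$, $c_S=\arg\max_i\xi_i$, $\xi_{\max}=\max_i\xi_i$. The candidates arrive one per round, in rounds $1,\dots,n$, in uniformly random order. The receiver knows the set of pairs $(\rho_i,\xi_i)$ and the distribution of the arrival order. The sender knows $n$ but not the pairs; in round $t$ she observes the pair of the arriving candidate and sends a signal $\sigma_t\in\{\mathrm{HIRE},\mathrm{NOT}\}$, which may depend on the pairs of the candidates that arrived in rounds $1,\dots,t$ and on internal randomness drawn at the start. Besides her a-priori information and the mechanism, to which the sender is committed, the receiver observes only the signals (no disclosure). After $\sigma_t$ she either irrevocably hires the current candidate, which ends the process, or rejects it for good. The receiver wants to maximize the probability of hiring $c_R$. The mechanism is \emph{persuasive} if, for all values as above, every round $t$ and every sequence of signals $(\mathrm{NOT},\dots,\mathrm{NOT},\sigma_t)$ of positive probability for rounds $1,\dots,t$, the following holds. Among all strategies of a receiver who has not hired before round $t$ (deciding in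 each round $r\ge t$ as a function of $\sigma_1,\dots,\sigma_r$), the obedient one, which hires exactly upon $\mathrm{HIRE}$, maximizes the probability of hiring $c_R$ conditional on the signals of rounds $1,\dots,t$. \textbf{Simple Secretary mechanism.} Let $s=\lfloor n/e\rfloor$. Once, at the start, set $v=\rho$ with probability $e/n$ and $v=\xi$ with probability $1-e/n$, independently of the arrival order. Signal $\mathrm{NOT}$ in rounds $1,\dots,s$, then signal $\mathrm{HIRE}$ on the first candidate in a round $t>s$ whose $v$-value exceeds those of all earlier candidates; if no $\mathrm{HIRE}$ was sent in rounds $1,\dots,n-1$, signal $\mathrm{HIRE}$ in round $n$. After a $\mathrm{HIRE}$ signal, all later signals are $\mathrm{NOT}$. \textbf{Theorem.} For every $n\ge 3$ the Simple Secretary mechanism is persuasive. Moreover, there is a sequence $(\varepsilon_n)$ with $\varepsilon_n\to 0$ such that, for all $n\ge 3$ and all values as above, if the receiver is obedient, then the probability that $c_S$ is hired differs from $1/e$ by at most $\varepsilon_n$, and the expected sender utility of the hired candidate is at least $(1/e-\varepsilon_n)\,\xi_{\max}$. -/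

import Mathlib

open Filter Topology

noncomputable section

namespace OnlinePersuasion

/-- The two direct signals. -/
inductive Signal
  | HIRE
  | NOT

/-- An instance with `n` candidates: candidate `i` has utility `ρ i` for the receiver and `ξ i`
for the sender.  All utilities are non-negative, and neither player has ties. -/
structure Instance (n : ℕ) where
  ρ : Fin n → ℝ
  ξ : Fin n → ℝ
  ρ_nonneg : ∀ i, 0 ≤ ρ i
  ξ_nonneg : ∀ i, 0 ≤ ξ i
  ρ_injective : Function.Injective ρ
  ξ_injective : Function.Injective ξ

namespace Instance

variable {n : ℕ}

/-- The valuation pair `(ρ, ξ)` of a candidate. -/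
def pair (I : Instance n) (i : Fin n) : ℝ × ℝ := (I.ρ i, I.ξ i)

/-- The largest sender utility. -/
def ξMax (I : Instance n) : ℝ := ⨆ i, I.ξ i

/-- Candidate `c` is the receiver-optimal candidate. -/
def IsReceiverBest (I : Instance n) (c : Fin n) : Prop := ∀ i, I.ρ i ≤ I.ρ c

/-- Candidate `c` is the sender-optimal candidate. -/
def IsSenderBest (I : Instance n) (c : Fin n) : Prop := ∀ i, I.ξ i ≤ I.ξ c

end Instance

/-- A (randomized) direct mechanism for `n` candidates in the secretary scenario without
disclosure.  The sender draws a seed `ω` with probability `law ω`; the signal in round `t`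
depends only on the seed and on the valuation pairs of the candidates that arrived in the rounds
`0, …, t`.  (Rounds are numbered from `0` to `n - 1`.) -/
structure Mechanism (n : ℕ) where
  Seed : Type
  [seedFintype : Fintype Seed]
  law : Seed → ℝ
  law_nonneg : ∀ ω, 0 ≤ law ω
  law_sum : ∑ ω, law ω = 1
  signal : Seed → (t : Fin n) → (Set.Iic t → ℝ × ℝ) → Signal

attribute [instance] Mechanism.seedFintype

/-- A receiver strategy without disclosure: in each round `t`, whether she hires the current
candidate, as a function of the signals of the rounds `0, …, t`. -/
def Strategy (n : ℕ) : Type := (t : Fin n) → (Set.Iic t → Signal) → Prop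

/-- The obedient strategy: hire exactly upon the signal `HIRE`. -/
def obedient (n : ℕ) : Strategy n := fun t h => h ⟨t, Set.mem_Iic.2 le_rfl⟩ = Signal.HIRE

/-- A receiver who has not hired before round `t`, follows `d` from round `t` on and faces the
signals `σ`, hires in round `r`: it is the first round from `t` on in which `d` says to hire. -/
def HiresAt {n : ℕ} (d : Strategy n) (σ : Fin n → Signal) (t : ℕ) (r : Fin n) : Prop :=
  t ≤ r.val ∧ d r (fun i => σ i) ∧
    ∀ q : Fin n, t ≤ q.val → q < r → ¬ d q (fun i => σ i)

namespace Mechanism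

variable {n : ℕ} (M : Mechanism n) (I : Instance n)

/-- The elementary outcomes: an arrival order (`π t` arrives in round `t`) and a seed. -/
abbrev Outcome : Type := Equiv.Perm (Fin n) × M.Seed

/-- The arrival order is uniform and independent of the seed. -/
def weight (o : M.Outcome) : ℝ := (1 / (n.factorial : ℝ)) * M.law o.2

/-- Expectation over arrival order and internal randomness. -/
def expect (f : M.Outcome → ℝ) : ℝ := ∑ o, M.weight o * f o

open Classical in
/-- Probability of an event. -/
def prob (E : M.Outcome → Prop) : ℝ := M.expect fun o => if E o then 1 else 0

/-- Conditional probability of `E` given `H` (used only if `H` has positive probability). -/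
def condProb (E H : M.Outcome → Prop) : ℝ := M.prob (fun o => E o ∧ H o) / M.prob H

/-- The signals sent in all rounds. -/
def signals (o : M.Outcome) (t : Fin n) : Signal :=
  M.signal o.2 t fun i => I.pair (o.1 i)

/-- The receiver, not having hired before round `t` and following `d` from round `t` on, hires
her best candidate. -/
def ReceiverSuccess (d : Strategy n) (t : ℕ) (o : M.Outcome) : Prop :=
  ∃ r, HiresAt d (M.signals I o) t r ∧ I.IsReceiverBest (o.1 r)

/-- The signals of the rounds `0, …, t` are `h`. -/
def HistoryIs (t : Fin n) (h : Set.Iic t → Signal) (o : M.Outcome) : Prop :=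
  ∀ i : Set.Iic t, M.signals I o i = h i

/-- Persuasiveness for ordinal receiver utility without disclosure.  On every instance, in every
round `t` that an obedient receiver can reach without having hired (all earlier signals are
`NOT`), and for every signal she may receive in round `t`, obedience from round `t` on maximizes
her success probability, conditional on the signals she has received, among all strategies. -/
def Persuasive : Prop :=
  ∀ I : Instance n, ∀ (t : Fin n) (h : Set.Iic t → Signal),
    (∀ i : Set.Iic t, (i : Fin n) < t → h i = Signal.NOT) →
    0 < M.prob (M.HistoryIs I t h) →
    ∀ d : Strategy n,
      M.condProb (M.ReceiverSuccess I d t) (M.HistoryIs I t h) ≤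
        M.condProb (M.ReceiverSuccess I (obedient n) t) (M.HistoryIs I t h)

/-- The sender's success probability when the receiver is obedient. -/
def senderSuccess : ℝ :=
  M.prob fun o => ∃ r, HiresAt (obedient n) (M.signals I o) 0 r ∧ I.IsSenderBest (o.1 r)

open Classical in
/-- The sender's expected utility when the receiver is obedient (at most one round `r`
contributes: the one in which the receiver hires). -/
def senderUtility : ℝ :=
  M.expect fun o =>
    ∑ r, if HiresAt (obedient n) (M.signals I o) 0 r then I.ξ (o.1 r) else 0

end Mechanism

/-- The classic algorithm with sample size `s`, before accounting for earlier `HIRE` signals: the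
candidate of round `t` qualifies if `t` is not among the first `s` rounds and the candidate has
the best value so far, or if `t` is the last round. -/
def Qualifies (n s : ℕ) (t : Fin n) (v : Set.Iic t → ℝ) : Prop :=
  (s ≤ t.val ∧ ∀ i : Set.Iic t, (i : Fin n) < t → v i < v ⟨t, Set.mem_Iic.2 le_rfl⟩) ∨ t.val + 1 = n

open Classical in
/-- The classic algorithm signals `HIRE` in the first round whose candidate qualifies, and `NOT`
in all other rounds. -/
def classicSignal (n s : ℕ) (t : Fin n) (v : Set.Iic t → ℝ) : Signal :=
  if Qualifies n s t v ∧
      ∀ q : Set.Iic t, (q : Fin n) < t →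
        ¬ Qualifies n s q (fun i => v ⟨i, Set.mem_Iic.2 (le_trans (Set.mem_Iic.1 i.2) (Set.mem_Iic.1 q.2))⟩)
  then Signal.HIRE else Signal.NOT

theorem exp_one_le_of_three_le {n : ℕ} (hn : 3 ≤ n) : Real.exp 1 / n ≤ 1 := by
  have h3 : (3 : ℝ) ≤ n := by exact_mod_cast hn
  rw [div_le_one (by linarith)]
  linarith [Real.exp_one_lt_d9]

/-- The Simple Secretary mechanism: the classic algorithm with sample size `⌊n / e⌋`, run on the
receiver values with probability `e / n` (seed `true`) and on the sender values with probability
`1 - e / n` (seed `false`).  The choice is made once, before the first round. -/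
def simpleSecretary (n : ℕ) (hn : 3 ≤ n) : Mechanism n where
  Seed := Bool
  law b := if b then Real.exp 1 / n else 1 - Real.exp 1 / n
  law_nonneg b := by
    have h := exp_one_le_of_three_le hn
    cases b
    · simpa using h
    · simpa using div_nonneg (Real.exp_pos 1).le (Nat.cast_nonneg n)
  law_sum := by simp
  signal b t x :=
    classicSignal n ⌊(n : ℝ) / Real.exp 1⌋₊ t fun i => if b then (x i).1 else (x i).2

end OnlinePersuasion

end

/-! For either seed there is exactly one `HIRE`, in a random round `T`. A history with no `HIRE`
before round `t` therefore says either `T = t` or `T > t`. Obedience and a deviation are conditioned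
on the same event, so joint probabilities can be compared, and two inequalities suffice: on `T = τ`,
the candidate of round `τ` is at least as likely to be `c_R` as that of any later round; on `T > r`,
the candidate of round `T` is at least as likely to be `c_R` as that of round `r`.

Write `s` for the sample size and `p = e / n`. The basic fact is that "candidate `c` arrives in
round `r`, and rounds `s, …, k - 1` bring no record of `v`" has probability `s / (k n)` for `k ≤ r`,
whatever `v` and `c` are (`permProb_noRecord`). So no relation between `ρ` and `ξ` enters. The first
inequality reduces to `1 ≤ p (τ + 1)`, true because `τ ≥ ⌊n / e⌋`. In the second, the loss from
letting `c_R` pass is offset by the later rounds under the `ρ` seed and the forced last round under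
the `ξ` seed (`wait_bound`).

The `ξ` seed has probability tending to 1, and under it `c_S` is hired with probability `(s / n) ∑ 1
/ j` over `s ≤ j < n`. This depends on `n` only and tends to `1 / e`, so the error is uniform in the
values. -/

namespace OnlinePersuasion

/-! ### Events of a uniformly random arrival order. -/

open Classical in
/-- The probability of an event under a uniformly random arrival order. -/
noncomputable def permProb {n : ℕ} (E : Equiv.Perm (Fin n) → Prop) : ℝ :=
  (1 / (n.factorial : ℝ)) * ∑ π, if E π then 1 else 0

section PermProb

variable {n : ℕ}

theorem permProb_mono {E F : Equiv.Perm (Fin n) → Prop} (h : ∀ π, E π → F π) :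
    permProb E ≤ permProb F := by
  unfold permProb
  gcongr with π
  split_ifs with h1 h2 h2
  · rfl
  · exact absurd (h π h1) h2
  · exact zero_le_one
  · rfl

theorem permProb_congr {E F : Equiv.Perm (Fin n) → Prop} (h : ∀ π, E π ↔ F π) :
    permProb E = permProb F :=
  le_antisymm (permProb_mono fun π => (h π).1) (permProb_mono fun π => (h π).2)

theorem permProb_nonneg (E : Equiv.Perm (Fin n) → Prop) : 0 ≤ permProb E := by
  unfold permProb
  refine mul_nonneg (by positivity) (Finset.sum_nonneg fun π _ => ?_)
  split_ifs <;> norm_num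

theorem permProb_true : permProb (fun _ : Equiv.Perm (Fin n) => True) = 1 := by
  have : (n.factorial : ℝ) ≠ 0 := by exact_mod_cast n.factorial_ne_zero
  simp [permProb, Fintype.card_perm, this]

theorem permProb_le_one (E : Equiv.Perm (Fin n) → Prop) : permProb E ≤ 1 :=
  (permProb_mono fun _ _ => trivial).trans permProb_true.le

theorem permProb_eq_zero {E : Equiv.Perm (Fin n) → Prop} (h : ∀ π, ¬ E π) : permProb E = 0 := by
  simp [permProb, h]

theorem permProb_split (E F : Equiv.Perm (Fin n) → Prop) :
    permProb E = permProb (fun π => E π ∧ F π) + permProb (fun π => E π ∧ ¬ F π) := by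
  unfold permProb
  rw [← mul_add, ← Finset.sum_add_distrib]
  congr 1
  refine Finset.sum_congr rfl fun π _ => ?_
  by_cases h1 : E π <;> by_cases h2 : F π <;> simp [h1, h2]

/-- Decomposition of an event according to the one index in `S` at which a property holds. -/
theorem permProb_eq_sum {ι : Type*} (S : Finset ι) (E : Equiv.Perm (Fin n) → Prop)
    (A : ι → Equiv.Perm (Fin n) → Prop)
    (hex : ∀ π, E π → ∃ j ∈ S, A j π)
    (huniq : ∀ π, ∀ i ∈ S, ∀ j ∈ S, A i π → A j π → i = j) :
    permProb E = ∑ j ∈ S, permProb (fun π => E π ∧ A j π) := by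
  classical
  unfold permProb
  rw [← Finset.mul_sum, Finset.sum_comm]
  congr 1
  refine Finset.sum_congr rfl fun π _ => ?_
  by_cases h : E π
  · obtain ⟨j, hj, hA⟩ := hex π h
    rw [Finset.sum_eq_single_of_mem j hj]
    · simp [h, hA]
    · intro i hi hij
      rw [if_neg]
      exact fun hh => hij (huniq π i hi j hj hh.2 hA)
  · simp [h]

theorem permProb_comp (e : Equiv.Perm (Fin n) ≃ Equiv.Perm (Fin n))
    (E : Equiv.Perm (Fin n) → Prop) : permProb (fun π => E (e π)) = permProb E := by
  unfold permProb
  congr 1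
  classical
  exact e.sum_comp fun π => (if E π then (1 : ℝ) else 0)

/-- Relabelling candidates by a transposition shows that all `n` candidates are equally likely in
round `r`. -/
theorem permProb_apply_eq (r c : Fin n) : permProb (fun π => π r = c) = 1 / n := by
  have hn : (n : ℝ) ≠ 0 := by
    have := r.pos
    positivity
  have hsum := permProb_eq_sum (n := n) Finset.univ (fun _ => True) (fun d π => π r = d)
    (fun π _ => ⟨π r, Finset.mem_univ _, rfl⟩) (fun π i _ j _ hi hj => hi.symm.trans hj)
  have heq : ∀ d : Fin n, permProb (fun π => True ∧ π r = d) = permProb (fun π => π r = c) := by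
    intro d
    rw [← permProb_comp (Equiv.mulLeft (Equiv.swap c d)) fun π => True ∧ π r = d]
    refine permProb_congr fun π => ?_
    simp [Equiv.swap_apply_eq_iff]
  rw [permProb_true, Finset.sum_congr rfl fun d _ => heq d] at hsum
  simp only [Finset.sum_const, Finset.card_univ, Fintype.card_fin, nsmul_eq_mul] at hsum
  rw [eq_div_iff hn]
  linarith

/-! ### Records in the arrival order. -/

/-- None of the rounds in `[s, k)` brings a new best candidate with respect to `v`. -/
def NoRecord (s k : ℕ) (v : Fin n → ℝ) (π : Equiv.Perm (Fin n)) : Prop :=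
  ∀ q : Fin n, s ≤ q.val → q.val < k → ∃ i < q, v (π q) < v (π i)

theorem noRecord_iff {s k : ℕ} (hs : 0 < s) (hsk : s ≤ k) (hk : k < n) {v : Fin n → ℝ}
    (hv : Function.Injective v) (π : Equiv.Perm (Fin n)) :
    NoRecord s k v π ↔ ∃ j : Fin n, j.val < s ∧ ∀ i : Fin n, i.val < k → v (π i) ≤ v (π j) := by
  constructor
  · intro h
    obtain ⟨j, hj, hmax⟩ := Finset.exists_max_image
      (Finset.univ.filter fun i : Fin n => i.val < k) (fun i => v (π i))
      ⟨⟨0, by omega⟩, by simp; omega⟩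
    simp only [Finset.mem_filter, Finset.mem_univ, true_and] at hj hmax
    refine ⟨j, ?_, hmax⟩
    by_contra hjs
    obtain ⟨i, hij, hlt⟩ := h j (by omega) hj
    exact absurd (hmax i (lt_trans hij hj)) (not_le.2 hlt)
  · rintro ⟨j, hj, hmax⟩ q hq hqk
    have hne : j ≠ q := by
      rintro rfl
      omega
    refine ⟨j, Fin.lt_def.2 (by omega), lt_of_le_of_ne (hmax q hqk) fun h => hne ?_⟩
    exact (π.injective (hv h)).symm

/-- Given who arrives in round `r`, the best of the first `k ≤ r` candidates is equally likely to
arrive in each of the rounds before `k`. -/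
theorem permProb_argmax {k : ℕ} {v : Fin n → ℝ} (hv : Function.Injective v) {r : Fin n}
    (hk : k ≤ r.val) (c : Fin n) {j : Fin n} (hj : j.val < k) :
    permProb (fun π => π r = c ∧ ∀ i : Fin n, i.val < k → v (π i) ≤ v (π j)) =
      1 / (k * n) := by
  have hn : (n : ℝ) ≠ 0 := by
    have := r.pos
    positivity
  have hk0 : (k : ℝ) ≠ 0 := by
    have : 0 < k := by omega
    positivity
  have hsum := permProb_eq_sum (Finset.univ.filter fun i : Fin n => i.val < k)
    (fun π : Equiv.Perm (Fin n) => π r = c)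
    (fun j π => ∀ i : Fin n, i.val < k → v (π i) ≤ v (π j))
    (fun π _ => by
      obtain ⟨j, hj, hmax⟩ := Finset.exists_max_image
        (Finset.univ.filter fun i : Fin n => i.val < k) (fun i => v (π i)) ⟨j, by simpa using hj⟩
      exact ⟨j, hj, fun i hi => hmax i (by simpa using hi)⟩)
    (fun π a ha b hb h1 h2 => by
      simp only [Finset.mem_filter, Finset.mem_univ, true_and] at ha hb
      exact π.injective (hv (le_antisymm (h2 a ha) (h1 b hb))))
  have heq : ∀ l ∈ Finset.univ.filter (fun i : Fin n => i.val < k),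
      permProb (fun π => π r = c ∧ ∀ i : Fin n, i.val < k → v (π i) ≤ v (π l)) =
      permProb (fun π => π r = c ∧ ∀ i : Fin n, i.val < k → v (π i) ≤ v (π j)) := by
    intro l hl
    simp only [Finset.mem_filter, Finset.mem_univ, true_and] at hl
    -- Exchanging the arrival rounds `l` and `j`, both below `k ≤ r`, fixes round `r` and permutes
    -- the first `k` rounds.
    rw [← permProb_comp (Equiv.mulRight (Equiv.swap l j)) fun π =>
      π r = c ∧ ∀ i : Fin n, i.val < k → v (π i) ≤ v (π l)]
    refine permProb_congr fun π => ?_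
    have hr : Equiv.swap l j r = r := by
      apply Equiv.swap_apply_of_ne_of_ne <;> rintro rfl <;> omega
    have hlt : ∀ i : Fin n, i.val < k → (Equiv.swap l j i).val < k := by
      intro i hi
      rw [Equiv.swap_apply_def]
      split_ifs <;> assumption
    simp only [Equiv.coe_mulRight, Equiv.Perm.mul_apply, hr, Equiv.swap_apply_left]
    refine and_congr_right fun _ => ⟨fun h i hi => ?_, fun h i hi => h _ (hlt i hi)⟩
    simpa using h _ (hlt i hi)
  have hcard : (Finset.univ.filter fun i : Fin n => i.val < k).card = k := by
    rw [Fin.card_filter_val_lt]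
    omega
  rw [Finset.sum_congr rfl heq, permProb_apply_eq, Finset.sum_const, hcard, nsmul_eq_mul] at hsum
  rw [eq_div_iff (mul_ne_zero hk0 hn)]
  field_simp at hsum
  linarith

/-- By `noRecord_iff` the best of the first `k` candidates must arrive in one of the first `s`
rounds; each of these contributes `1 / (k n)`. -/
theorem permProb_noRecord {s k : ℕ} (hs : 0 < s) (hsk : s ≤ k) {v : Fin n → ℝ}
    (hv : Function.Injective v) {r : Fin n} (hk : k ≤ r.val) (c : Fin n) :
    permProb (fun π => π r = c ∧ NoRecord s k v π) = s / (k * n) := by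
  have hr := r.isLt
  rw [permProb_eq_sum (Finset.univ.filter fun i : Fin n => i.val < s) _
    (fun j π => ∀ i : Fin n, i.val < k → v (π i) ≤ v (π j))]
  · have : ∀ j ∈ Finset.univ.filter (fun i : Fin n => i.val < s),
        permProb (fun π => (π r = c ∧ NoRecord s k v π) ∧
          ∀ i : Fin n, i.val < k → v (π i) ≤ v (π j)) = 1 / (k * n) := by
      intro j hj
      simp only [Finset.mem_filter, Finset.mem_univ, true_and] at hj
      rw [← permProb_argmax hv hk c (lt_of_lt_of_le hj hsk)]
      refine permProb_congr fun π => ⟨fun h => ⟨h.1.1, h.2⟩, fun h => ⟨⟨h.1, ?_⟩, h.2⟩⟩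
      exact (noRecord_iff hs hsk (by omega) hv π).2 ⟨j, hj, h.2⟩
    rw [Finset.sum_congr rfl this, Finset.sum_const, Fin.card_filter_val_lt, nsmul_eq_mul,
      min_eq_right (by omega)]
    ring
  · intro π h
    obtain ⟨j, hj, hmax⟩ := (noRecord_iff hs hsk (by omega) hv π).1 h.2
    exact ⟨j, by simpa using hj, hmax⟩
  · intro π a ha b hb h1 h2
    simp only [Finset.mem_filter, Finset.mem_univ, true_and] at ha hb
    exact π.injective (hv (le_antisymm (h2 a (by omega)) (h1 b (by omega))))

/-! ### The hiring round of the classic algorithm. -/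

/-- The classic algorithm with values `v` and sample size `s` hires in round `t`. -/
def ClassicHires (s : ℕ) (v : Fin n → ℝ) (π : Equiv.Perm (Fin n)) (t : Fin n) : Prop :=
  Qualifies n s t (fun i => v (π i)) ∧ ∀ q < t, ¬ Qualifies n s q (fun i => v (π i))

theorem qualifies_comp_iff {s : ℕ} {v : Fin n → ℝ} {π : Equiv.Perm (Fin n)} {t : Fin n} :
    Qualifies n s t (fun i => v (π i)) ↔
      (s ≤ t.val ∧ ∀ i < t, v (π i) < v (π t)) ∨ t.val + 1 = n := by
  unfold Qualifies
  refine or_congr_left (and_congr_right fun _ => ?_)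
  exact ⟨fun h i hi => h ⟨i, hi.le⟩ hi, fun h i hi => h i hi⟩

theorem classicHires_unique {s : ℕ} {v : Fin n → ℝ} {π : Equiv.Perm (Fin n)} {t u : Fin n}
    (ht : ClassicHires s v π t) (hu : ClassicHires s v π u) : t = u := by
  rcases lt_trichotomy t u with h | h | h
  · exact absurd ht.1 (hu.2 t h)
  · exact h
  · exact absurd hu.1 (ht.2 u h)

theorem exists_classicHires (hn : 0 < n) (s : ℕ) (v : Fin n → ℝ) (π : Equiv.Perm (Fin n)) :
    ∃ t, ClassicHires s v π t := by
  have hex : ∃ t : Fin n, Qualifies n s t (fun i => v (π i)) :=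
    ⟨⟨n - 1, by omega⟩, Or.inr (by simp; omega)⟩
  obtain ⟨t, ht, hmin⟩ := WellFounded.has_min (wellFounded_lt (α := Fin n))
    {t | Qualifies n s t (fun i => v (π i))} hex
  exact ⟨t, ht, fun q hq hQ => hmin q hQ hq⟩

/-- A round before `t` is never the last one, so it can qualify only by bringing a record. -/
theorem forall_not_qualifies_iff {s : ℕ} {v : Fin n → ℝ} (hv : Function.Injective v)
    {π : Equiv.Perm (Fin n)} {t : Fin n} :
    (∀ q < t, ¬ Qualifies n s q (fun i => v (π i))) ↔ NoRecord s t.val v π := by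
  constructor
  · intro h q hq hqt
    have h1 := h q hqt
    rw [qualifies_comp_iff] at h1
    push Not at h1
    obtain ⟨i, hi, hle⟩ := h1.1 hq
    exact ⟨i, hi, lt_of_le_of_ne hle fun he => hi.ne' (π.injective (hv he))⟩
  · intro h q hq hQ
    rw [qualifies_comp_iff] at hQ
    rcases hQ with ⟨hs, hQ⟩ | hQ
    · obtain ⟨i, hi, hlt⟩ := h q hs hq
      exact absurd (hQ i hi) (not_lt.2 hlt.le)
    · have := t.isLt
      have : q.val < t.val := hq
      omega

theorem classicHires_iff {s : ℕ} {v : Fin n → ℝ} (hv : Function.Injective v)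
    {π : Equiv.Perm (Fin n)} {t : Fin n} :
    ClassicHires s v π t ↔
      ((s ≤ t.val ∧ ∀ i < t, v (π i) < v (π t)) ∨ t.val + 1 = n) ∧ NoRecord s t.val v π := by
  rw [ClassicHires, forall_not_qualifies_iff hv, qualifies_comp_iff]

theorem ClassicHires.le {s : ℕ} (hsn : s < n) {v : Fin n → ℝ} {π : Equiv.Perm (Fin n)} {t : Fin n}
    (h : ClassicHires s v π t) : s ≤ t.val := by
  rcases qualifies_comp_iff.1 h.1 with h | h <;> omega

/-- The best candidate is hired in round `t` iff there is no hiring before. -/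
theorem permProb_classicHires_best {s : ℕ} (hs : 0 < s) {v : Fin n → ℝ}
    (hv : Function.Injective v) {c : Fin n} (hc : ∀ i, v i ≤ v c) {t : Fin n} (ht : s ≤ t.val) :
    permProb (fun π => ClassicHires s v π t ∧ π t = c) = s / (t.val * n) := by
  rw [← permProb_noRecord hs ht hv le_rfl c]
  refine permProb_congr fun π => ?_
  rw [classicHires_iff hv]
  refine ⟨fun h => ⟨h.2, h.1.2⟩, fun h => ⟨⟨Or.inl ⟨ht, fun i hi => ?_⟩, h.2⟩, h.1⟩⟩
  rw [h.1]
  refine lt_of_le_of_ne (hc _) fun he => hi.ne (π.injective ?_)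
  rw [h.1, hv he]

/-- The last round qualifies automatically, so hiring there means only that no record came before;
hence `c` may be arbitrary. -/
theorem permProb_classicHires_last {s : ℕ} (hs : 0 < s) {v : Fin n → ℝ}
    (hv : Function.Injective v) (c : Fin n) {t : Fin n} (ht : s ≤ t.val) (hlast : t.val + 1 = n) :
    permProb (fun π => ClassicHires s v π t ∧ π t = c) = s / (t.val * n) := by
  rw [← permProb_noRecord hs ht hv le_rfl c]
  refine permProb_congr fun π => ?_
  rw [classicHires_iff hv]
  tauto

/-- Round `t` is not the last, so hiring in it means that the record-free run reaches `t` but does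
not extend through `t`. The probability is the difference of two values of `permProb_noRecord`. -/
theorem permProb_classicHires_later {s : ℕ} (hs : 0 < s) {v : Fin n → ℝ}
    (hv : Function.Injective v) (c : Fin n) {t r : Fin n} (ht : s ≤ t.val) (hr : t < r) :
    permProb (fun π => ClassicHires s v π t ∧ π r = c) =
      s / (t.val * n) - s / ((t.val + 1) * n) := by
  have hr' : t.val < r.val := hr
  have h1 := permProb_noRecord hs ht hv (r := r) (by omega) c
  have h2 := permProb_noRecord hs (k := t.val + 1) (by omega) hv (r := r) (by omega) c
  push_cast at h2
  rw [← h1, ← h2, eq_sub_iff_add_eq,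
    permProb_split (fun π => π r = c ∧ NoRecord s t.val v π) (ClassicHires s v · t)]
  congr 1
  · refine permProb_congr fun π => ?_
    rw [classicHires_iff hv]
    tauto
  · refine permProb_congr fun π => ?_
    rw [classicHires_iff hv]
    constructor
    · rintro ⟨hrc, h⟩
      refine ⟨⟨hrc, fun q hq hqt => h q hq (by omega)⟩, ?_⟩
      rintro ⟨⟨-, hmax⟩ | hlast, -⟩
      · obtain ⟨i, hi, hlt⟩ := h t ht (by omega)
        exact absurd (hmax i hi) (not_lt.2 hlt.le)
      · have := r.isLt
        omega
    · rintro ⟨⟨hrc, h⟩, hnot⟩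
      refine ⟨hrc, fun q hq hqt => ?_⟩
      rcases Nat.lt_succ_iff_lt_or_eq.1 hqt with hlt | heq
      · exact h q hq hlt
      · obtain rfl : q = t := Fin.ext heq
        by_contra hcon
        push Not at hcon
        refine hnot ⟨Or.inl ⟨hq, fun i hi => ?_⟩, h⟩
        exact lt_of_le_of_ne (hcon i hi) fun he => hi.ne (π.injective (hv he))

end PermProb

end OnlinePersuasion

/-! ### Probability calculus for mechanisms. -/

namespace OnlinePersuasion

namespace Mechanism

variable {n : ℕ} (M : Mechanism n)

theorem prob_eq_sum_permProb (E : M.Outcome → Prop) :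
    M.prob E = ∑ b, M.law b * permProb fun π => E (π, b) := by
  unfold prob expect weight permProb
  rw [Fintype.sum_prod_type_right]
  refine Finset.sum_congr rfl fun b _ => ?_
  rw [Finset.mul_sum, Finset.mul_sum]
  refine Finset.sum_congr rfl fun π _ => ?_
  ring

theorem weight_nonneg (o : M.Outcome) : 0 ≤ M.weight o :=
  mul_nonneg (by positivity) (M.law_nonneg o.2)

theorem expect_mono {f g : M.Outcome → ℝ} (h : ∀ o, f o ≤ g o) : M.expect f ≤ M.expect g :=
  Finset.sum_le_sum fun o _ => mul_le_mul_of_nonneg_left (h o) (M.weight_nonneg o)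

theorem prob_mono {E F : M.Outcome → Prop} (h : ∀ o, E o → F o) : M.prob E ≤ M.prob F := by
  refine M.expect_mono fun o => ?_
  split_ifs with h1 h2 h2
  · rfl
  · exact absurd (h o h1) h2
  · exact zero_le_one
  · rfl

theorem prob_nonneg (E : M.Outcome → Prop) : 0 ≤ M.prob E := by
  refine Finset.sum_nonneg fun o _ => mul_nonneg (M.weight_nonneg o) ?_
  dsimp only
  split_ifs <;> norm_num

theorem prob_eq_zero {E : M.Outcome → Prop} (h : ∀ o, ¬ E o) : M.prob E = 0 := by
  simp [prob, expect, h]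

theorem prob_split (E F : M.Outcome → Prop) :
    M.prob E = M.prob (fun o => E o ∧ F o) + M.prob (fun o => E o ∧ ¬ F o) := by
  unfold prob expect
  rw [← Finset.sum_add_distrib]
  refine Finset.sum_congr rfl fun o _ => ?_
  rw [← mul_add]
  congr 1
  by_cases h1 : E o <;> by_cases h2 : F o <;> simp [h1, h2]

theorem prob_eq_sum_fiber {ι : Type*} [Fintype ι] (E : M.Outcome → Prop) (T : M.Outcome → ι) :
    M.prob E = ∑ j, M.prob fun o => E o ∧ T o = j := by
  classical
  unfold prob expect
  rw [Finset.sum_comm]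
  refine Finset.sum_congr rfl fun o _ => ?_
  rw [← Finset.mul_sum]
  congr 1
  by_cases h : E o <;> simp [h]

end Mechanism

/-! ### Reduction of persuasiveness to two inequalities. -/

section Obedience

variable {n : ℕ}

open Classical in
/-- The signals of a mechanism that signals `HIRE` exactly in round `τ`. -/
noncomputable def singleHire (τ : Fin n) : Fin n → Signal :=
  fun i => if i = τ then Signal.HIRE else Signal.NOT

theorem singleHire_eq_hire {τ i : Fin n} : singleHire τ i = Signal.HIRE ↔ i = τ := by
  unfold singleHire
  split_ifs with h <;> simp [h]

theorem singleHire_eq_not {τ i : Fin n} : singleHire τ i = Signal.NOT ↔ i ≠ τ := by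
  unfold singleHire
  split_ifs with h <;> simp [h]

theorem hiresAt_unique {d : Strategy n} {σ : Fin n → Signal} {t : ℕ} {r r' : Fin n}
    (h : HiresAt d σ t r) (h' : HiresAt d σ t r') : r = r' := by
  rcases lt_trichotomy r r' with hlt | heq | hlt
  · exact absurd h.2.1 (h'.2.2 r h.1 hlt)
  · exact heq
  · exact absurd h'.2.1 (h.2.2 r' h'.1 hlt)

theorem hiresAt_obedient_singleHire {τ r : Fin n} {t : ℕ} (ht : t ≤ τ.val) :
    HiresAt (obedient n) (singleHire τ) t r ↔ r = τ := by
  unfold HiresAt obedient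
  simp only [singleHire_eq_hire]
  constructor
  · exact fun h => h.2.1
  · rintro rfl
    exact ⟨ht, rfl, fun q _ hq => hq.ne⟩

/-- Before the `HIRE` signal, all histories are constantly `NOT`. -/
theorem strategy_singleHire_of_lt (d : Strategy n) {τ q : Fin n} (h : q < τ) :
    (d q fun i => singleHire τ i) = d q fun _ => Signal.NOT := by
  congr 1
  funext i
  exact singleHire_eq_not.2 (lt_of_le_of_lt i.2 h).ne

namespace Mechanism

/-- If `HIRE` is sent in exactly one round `T`, obedience is optimal given any reachable history,
provided that a `HIRE` signal always favours the current candidate over any later one, and that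
before the `HIRE` signal waiting for it is better than hiring at once. -/
theorem condProb_receiverSuccess_le (M : Mechanism n) (I : Instance n) {c : Fin n}
    (hc : ∀ i, I.IsReceiverBest i ↔ i = c) (T : M.Outcome → Fin n)
    (hT : ∀ o, M.signals I o = singleHire (T o))
    (hire : ∀ τ r, τ < r →
      M.prob (fun o => T o = τ ∧ o.1 r = c) ≤ M.prob (fun o => T o = τ ∧ o.1 τ = c))
    (wait : ∀ r, M.prob (fun o => r < T o ∧ o.1 r = c) ≤
      M.prob (fun o => r < T o ∧ o.1 (T o) = c))
    (t : Fin n) (h : Set.Iic t → Signal) (hnot : ∀ i : Set.Iic t, (i : Fin n) < t → h i = Signal.NOT)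
    (d : Strategy n) :
    M.condProb (M.ReceiverSuccess I d t) (M.HistoryIs I t h) ≤
      M.condProb (M.ReceiverSuccess I (obedient n) t) (M.HistoryIs I t h) := by
  unfold condProb
  refine div_le_div_of_nonneg_right ?_ (M.prob_nonneg _)
  have hob : ∀ o, t ≤ T o → (M.ReceiverSuccess I (obedient n) t o ↔ o.1 (T o) = c) := by
    intro o ho
    unfold ReceiverSuccess
    simp only [hT, hc, hiresAt_obedient_singleHire (Fin.le_def.1 ho), exists_eq_left]
  -- Given `T o = τ` all signals are determined, so `d` hires in one fixed round or never. As `d`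
  -- does not hire on `NOT` signals before `τ`, that round is at least `τ`, and `hire` applies.
  have hround : ∀ τ, t ≤ τ → (∀ q, t ≤ q → q < τ → ¬ d q fun _ => Signal.NOT) →
      M.prob (fun o => T o = τ ∧ M.ReceiverSuccess I d t o) ≤
        M.prob (fun o => T o = τ ∧ o.1 τ = c) := by
    intro τ hτ hq
    by_cases hex : ∃ r, HiresAt d (singleHire τ) t r
    · obtain ⟨r, hr⟩ := hex
      have hsub : M.prob (fun o => T o = τ ∧ M.ReceiverSuccess I d t o) ≤
          M.prob (fun o => T o = τ ∧ o.1 r = c) := by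
        refine M.prob_mono ?_
        rintro o ⟨rfl, r', hr', hbest⟩
        rw [hT] at hr'
        rw [hiresAt_unique hr hr']
        exact ⟨rfl, (hc _).1 hbest⟩
      refine hsub.trans ?_
      rcases lt_trichotomy r τ with hlt | rfl | hlt
      · exfalso
        refine hq r hr.1 hlt ?_
        rw [← strategy_singleHire_of_lt d hlt]
        exact hr.2.1
      · exact le_rfl
      · exact hire τ r hlt
    · refine le_trans (M.prob_mono (F := fun _ => False) ?_) ?_
      · rintro o ⟨rfl, r, hr, -⟩
        rw [hT] at hr
        exact hex ⟨r, hr⟩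
      · rw [M.prob_eq_zero fun _ => id]
        exact M.prob_nonneg _
  have hwait : M.prob (fun o => M.ReceiverSuccess I d t o ∧ t < T o) ≤
      M.prob (fun o => o.1 (T o) = c ∧ t < T o) := by
    have hfollow : ∀ K : Fin n → Prop,
        (∀ τ, K τ → t < τ ∧ ∀ q, t ≤ q → q < τ → ¬ d q fun _ => Signal.NOT) →
        M.prob (fun o => M.ReceiverSuccess I d t o ∧ K (T o)) ≤
          M.prob (fun o => o.1 (T o) = c ∧ K (T o)) := by
      intro K hK
      rw [M.prob_eq_sum_fiber _ T, M.prob_eq_sum_fiber (fun o => o.1 (T o) = c ∧ K (T o)) T]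
      refine Finset.sum_le_sum fun τ _ => ?_
      by_cases hτ : K τ
      · refine le_trans (M.prob_mono ?_) ((hround τ (hK τ hτ).1.le (hK τ hτ).2).trans
          (M.prob_mono ?_))
        · exact fun o ho => ⟨ho.2, ho.1.1⟩
        · rintro o ⟨rfl, ho⟩
          exact ⟨⟨ho, hτ⟩, rfl⟩
      · rw [M.prob_eq_zero]
        · exact M.prob_nonneg _
        · rintro o ⟨⟨-, ho⟩, rfl⟩
          exact hτ ho
    -- On all-`NOT` histories `d` has a deterministic first hiring round `r`, if any. Outcomes with
    -- `T o ≤ r` are handled round by round; on those with `r < T o`, `d` hires in round `r`.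
    by_cases hex : ∃ q, t ≤ q ∧ d q fun _ => Signal.NOT
    · obtain ⟨r, ⟨htr, hdr⟩, hmin⟩ := WellFounded.has_min (wellFounded_lt (α := Fin n))
        {q | t ≤ q ∧ d q fun _ => Signal.NOT} hex
      have hbefore : ∀ q, t ≤ q → q < r → ¬ d q fun _ => Signal.NOT :=
        fun q h1 h2 h3 => hmin q ⟨h1, h3⟩ h2
      rw [M.prob_split _ (fun o => T o ≤ r),
        M.prob_split (fun o => o.1 (T o) = c ∧ t < T o) (fun o => T o ≤ r)]
      refine add_le_add ?_ ?_
      · have := hfollow (fun τ => t < τ ∧ τ ≤ r)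
          fun τ hτ => ⟨hτ.1, fun q h1 h2 => hbefore q h1 (lt_of_lt_of_le h2 hτ.2)⟩
        simpa only [and_assoc] using this
      · refine le_trans (M.prob_mono ?_) ((wait r).trans (M.prob_mono ?_))
        · rintro o ⟨⟨⟨r', hr', hbest⟩, -⟩, hTr⟩
          have hTr := not_le.1 hTr
          refine ⟨hTr, ?_⟩
          rw [hT] at hr'
          have : HiresAt d (singleHire (T o)) t r := by
            refine ⟨htr, ?_, fun q h1 h2 => ?_⟩
            · rw [strategy_singleHire_of_lt d hTr]
              exact hdr
            · rw [strategy_singleHire_of_lt d (h2.trans hTr)]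
              exact hbefore q h1 h2
          rw [hiresAt_unique this hr']
          exact (hc _).1 hbest
        · exact fun o ho => ⟨⟨ho.2, lt_of_le_of_lt htr ho.1⟩, not_le.2 ho.1⟩
    · push Not at hex
      exact hfollow (fun τ => t < τ) fun τ hτ => ⟨hτ, fun q h1 _ => hex q h1⟩
  cases hh : h ⟨t, Set.mem_Iic.2 le_rfl⟩ with
  | HIRE =>
    have hH : ∀ o, M.HistoryIs I t h o ↔ T o = t := by
      intro o
      unfold HistoryIs
      rw [hT]
      constructor
      · intro hi
        have := hi ⟨t, Set.mem_Iic.2 le_rfl⟩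
        rw [hh] at this
        exact (singleHire_eq_hire.1 this).symm
      · rintro rfl i
        rcases lt_or_eq_of_le (Set.mem_Iic.1 i.2) with hlt | heq
        · rw [hnot i hlt]
          exact singleHire_eq_not.2 hlt.ne
        · have : i = ⟨T o, Set.mem_Iic.2 le_rfl⟩ := Subtype.ext heq
          rw [this, hh]
          exact singleHire_eq_hire.2 rfl
    refine le_trans (M.prob_mono ?_) ((hround t le_rfl
      fun q h1 h2 => absurd h2 (not_lt.2 h1)).trans (M.prob_mono ?_))
    · exact fun o ho => ⟨(hH o).1 ho.2, ho.1⟩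
    · rintro o ⟨ho, hoc⟩
      refine ⟨(hob o ho.ge).2 ?_, (hH o).2 ho⟩
      rw [ho]
      exact hoc
  | NOT =>
    have hH : ∀ o, M.HistoryIs I t h o ↔ t < T o := by
      intro o
      have hall : ∀ i : Set.Iic t, h i = Signal.NOT := by
        intro i
        rcases lt_or_eq_of_le (Set.mem_Iic.1 i.2) with hlt | heq
        · exact hnot i hlt
        · rw [← hh]
          congr 1
          exact Subtype.ext heq
      unfold HistoryIs
      simp only [hT, hall, singleHire_eq_not]
      constructor
      · intro hi
        by_contra hle
        exact hi ⟨T o, not_lt.1 hle⟩ rfl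
      · exact fun hlt i => (lt_of_le_of_lt i.2 hlt).ne
    refine le_trans (M.prob_mono ?_) (hwait.trans (M.prob_mono ?_))
    · exact fun o ho => ⟨ho.1, (hH o).1 ho.2⟩
    · exact fun o ho => ⟨(hob o ho.2.le).2 ho.1, (hH o).2 ho.2⟩

end Mechanism

end Obedience

end OnlinePersuasion

namespace OnlinePersuasion

/-! ### Success probability of the classic algorithm. -/

section Classic

variable {n : ℕ}

theorem permProb_exists_classicHires (s : ℕ) (v : Fin n → ℝ)
    (P : Fin n → Equiv.Perm (Fin n) → Prop) :
    permProb (fun π => ∃ t, ClassicHires s v π t ∧ P t π) =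
      ∑ t, permProb fun π => ClassicHires s v π t ∧ P t π := by
  rw [permProb_eq_sum Finset.univ _ fun t π => ClassicHires s v π t]
  · refine Finset.sum_congr rfl fun t _ => permProb_congr fun π => ?_
    constructor
    · rintro ⟨⟨u, hu, hP⟩, ht⟩
      rw [classicHires_unique ht hu]
      exact ⟨hu, hP⟩
    · exact fun h => ⟨⟨t, h⟩, h.1⟩
  · rintro π ⟨t, ht, -⟩
    exact ⟨t, Finset.mem_univ t, ht⟩
  · exact fun π i _ j _ hi hj => classicHires_unique hi hj

/-- The probability that the classic algorithm hires the best candidate in a round `≥ k`. -/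
theorem permProb_classicHires_best_from {s k : ℕ} (hs : 0 < s) (hk : s ≤ k) {v : Fin n → ℝ}
    (hv : Function.Injective v) {c : Fin n} (hc : ∀ i, v i ≤ v c) :
    permProb (fun π => ∃ t, ClassicHires s v π t ∧ k ≤ t.val ∧ π t = c) =
      ∑ j ∈ Finset.Ico k n, (s : ℝ) / (j * n) := by
  rw [permProb_exists_classicHires]
  have hterm : ∀ t : Fin n, permProb (fun π => ClassicHires s v π t ∧ k ≤ t.val ∧ π t = c) =
      if k ≤ t.val then (s : ℝ) / (t.val * n) else 0 := by
    intro t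
    split_ifs with h
    · rw [← permProb_classicHires_best hs hv hc (hk.trans h)]
      exact permProb_congr fun π => by tauto
    · exact permProb_eq_zero fun π hπ => h hπ.2.1
  rw [Finset.sum_congr rfl fun t _ => hterm t,
    Fin.sum_univ_eq_sum_range (fun j => if k ≤ j then (s : ℝ) / (j * n) else 0), ← Finset.sum_filter]
  congr 1
  ext j
  simp
  tauto

end Classic

/-- Rejecting now and waiting for the end of the process is compensated by the later rounds. -/
theorem wait_bound {p : ℝ} {k m : ℕ} (hk : 0 < k) (hp : ∀ j : ℕ, k < j → 1 ≤ p * j)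
    (hkm : k ≤ m) :
    (1 - p) / k ≤ p * ∑ j ∈ Finset.Ico (k + 1) (m + 1), 1 / (j : ℝ) + (1 - p) / m := by
  induction m, hkm using Nat.le_induction with
  | base => simp
  | succ m hm ih =>
    rw [Finset.sum_Ico_succ_top (by omega), mul_add]
    have hm0 : (0 : ℝ) < m := by
      have : 0 < m := by omega
      exact_mod_cast this
    have hpm := hp (m + 1) (by omega)
    push_cast at hpm ⊢
    -- After clearing denominators this is exactly `1 ≤ p * (m + 1)`.
    have : (1 - p) / m ≤ p * (1 / ((m : ℝ) + 1)) + (1 - p) / (m + 1) := by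
      have h1 : p * (1 / ((m : ℝ) + 1)) + (1 - p) / (m + 1) = 1 / (m + 1) := by ring
      rw [h1, div_le_div_iff₀ hm0 (by linarith)]
      linarith
    linarith

/-! ### Persuasiveness of the Simple Secretary mechanism. -/

section SimpleSecretary

variable {n : ℕ}

/-- The sample size of the Simple Secretary mechanism. -/
noncomputable def sampleSize (n : ℕ) : ℕ := ⌊(n : ℝ) / Real.exp 1⌋₊

theorem sampleSize_pos (hn : 3 ≤ n) : 0 < sampleSize n := by
  refine Nat.floor_pos.2 ?_
  rw [one_le_div (Real.exp_pos 1)]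
  have h3 : (3 : ℝ) ≤ n := by exact_mod_cast hn
  linarith [Real.exp_one_lt_d9]

theorem sampleSize_lt (hn : 3 ≤ n) : sampleSize n < n := by
  refine (Nat.floor_lt (by positivity)).2 ?_
  have h3 : (0 : ℝ) < n := by
    have : 0 < n := by omega
    exact_mod_cast this
  exact div_lt_self h3 (by linarith [Real.exp_one_gt_d9])

theorem one_le_exp_div_mul {j : ℕ} (hn : 3 ≤ n) (hj : sampleSize n < j) :
    1 ≤ Real.exp 1 / n * j := by
  have h3 : (0 : ℝ) < n := by
    have : 0 < n := by omega
    exact_mod_cast this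
  have h := (Nat.floor_lt (by positivity)).1 hj
  rw [div_lt_iff₀ (Real.exp_pos 1)] at h
  rw [div_mul_eq_mul_div, one_le_div h3]
  linarith

/-- The values which the Simple Secretary mechanism uses with the given seed. -/
def Instance.value (I : Instance n) (b : Bool) : Fin n → ℝ := if b then I.ρ else I.ξ

theorem Instance.value_injective (I : Instance n) (b : Bool) : Function.Injective (I.value b) := by
  cases b
  · exact I.ξ_injective
  · exact I.ρ_injective

theorem simpleSecretary_signals_eq_hire (hn : 3 ≤ n) (I : Instance n)
    (π : Equiv.Perm (Fin n)) (b : Bool) (t : Fin n) :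
    (simpleSecretary n hn).signals I (π, b) t = Signal.HIRE ↔
      ClassicHires (sampleSize n) (I.value b) π t := by
  have h : (simpleSecretary n hn).signals I (π, b) t =
      classicSignal n (sampleSize n) t fun i => I.value b (π i) := by
    cases b <;> rfl
  rw [h, classicSignal, ClassicHires]
  constructor
  · intro hs
    split_ifs at hs with hq
    exact ⟨hq.1, fun q hqt => hq.2 ⟨q, hqt.le⟩ hqt⟩
  · intro hs
    exact if_pos ⟨hs.1, fun q hqt => hs.2 q hqt⟩

theorem exists_hireRound (hn : 3 ≤ n) (I : Instance n) :
    ∃ T : (simpleSecretary n hn).Outcome → Fin n,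
      (∀ o, (simpleSecretary n hn).signals I o = singleHire (T o)) ∧
      ∀ π (b : Bool) t, T (π, b) = t ↔ ClassicHires (sampleSize n) (I.value b) π t := by
  have hex : ∀ o : (simpleSecretary n hn).Outcome, ∃ t,
      (simpleSecretary n hn).signals I o t = Signal.HIRE := by
    rintro ⟨π, b⟩
    obtain ⟨t, ht⟩ := exists_classicHires (by omega) (sampleSize n) (I.value b) π
    exact ⟨t, (simpleSecretary_signals_eq_hire hn I π b t).2 ht⟩
  choose T hT using hex
  have hiff : ∀ π (b : Bool) t, T (π, b) = t ↔ ClassicHires (sampleSize n) (I.value b) π t := by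
    intro π b t
    have h := (simpleSecretary_signals_eq_hire hn I π b _).1 (hT (π, b))
    exact ⟨fun e => e ▸ h, fun ht => classicHires_unique h ht⟩
  refine ⟨T, ?_, hiff⟩
  rintro ⟨π, b⟩
  funext t
  cases hs : (simpleSecretary n hn).signals I (π, b) t with
  | HIRE =>
    refine (singleHire_eq_hire.2 ?_).symm
    exact ((hiff π b t).2 ((simpleSecretary_signals_eq_hire hn I π b t).1 hs)).symm
  | NOT =>
    refine (singleHire_eq_not.2 ?_).symm
    rintro rfl
    rw [hT] at hs
    cases hs

theorem simpleSecretary_prob (hn : 3 ≤ n) (E : (simpleSecretary n hn).Outcome → Prop) :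
    (simpleSecretary n hn).prob E =
      Real.exp 1 / n * permProb (fun π => E (π, true)) +
        (1 - Real.exp 1 / n) * permProb (fun π => E (π, false)) := by
  rw [Mechanism.prob_eq_sum_permProb]
  exact Fintype.sum_bool _

/-- For a later round both seeds give `s / (n τ (τ + 1))`. For round `τ` the `ρ` seed alone gives `p
s / (n τ)`, which is enough since `1 ≤ p (τ + 1)`; the `ξ` contribution is dropped. -/
theorem simpleSecretary_hire (hn : 3 ≤ n) (I : Instance n) {c : Fin n}
    (hc : I.IsReceiverBest c) {T : (simpleSecretary n hn).Outcome → Fin n}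
    (hT : ∀ π (b : Bool) t, T (π, b) = t ↔ ClassicHires (sampleSize n) (I.value b) π t)
    {τ r : Fin n} (hr : τ < r) :
    (simpleSecretary n hn).prob (fun o => T o = τ ∧ o.1 r = c) ≤
      (simpleSecretary n hn).prob (fun o => T o = τ ∧ o.1 τ = c) := by
  have hs := sampleSize_pos hn
  rcases lt_or_ge τ.val (sampleSize n) with hτ | hτ
  · rw [Mechanism.prob_eq_zero]
    · exact Mechanism.prob_nonneg _ _
    · rintro ⟨π, b⟩ ⟨h, -⟩
      have := ((hT π b τ).1 h).le (sampleSize_lt hn)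
      omega
  · have hprob : ∀ x, (simpleSecretary n hn).prob (fun o => T o = τ ∧ o.1 x = c) =
        Real.exp 1 / n *
            permProb (fun π => ClassicHires (sampleSize n) (I.value true) π τ ∧ π x = c) +
          (1 - Real.exp 1 / n) *
            permProb (fun π => ClassicHires (sampleSize n) (I.value false) π τ ∧ π x = c) := by
      intro x
      refine (simpleSecretary_prob hn _).trans (congrArg₂ _ (congrArg _ ?_) (congrArg _ ?_)) <;>
        exact permProb_congr fun π => and_congr_left' (hT π _ τ)
    rw [hprob, hprob, permProb_classicHires_later hs (I.value_injective _) c hτ hr,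
      permProb_classicHires_later hs (I.value_injective _) c hτ hr,
      permProb_classicHires_best hs (I.value_injective true) hc hτ]
    have hnn : 0 ≤ (1 - Real.exp 1 / n) * permProb (fun π =>
        ClassicHires (sampleSize n) (I.value false) π τ ∧ π τ = c) :=
      mul_nonneg (sub_nonneg.2 (exp_one_le_of_three_le hn)) (permProb_nonneg _)
    have hp := one_le_exp_div_mul (j := τ.val + 1) hn (by omega)
    set p := Real.exp 1 / n
    have hn0 : (0 : ℝ) < n := by
      have : 0 < n := by omega
      exact_mod_cast this
    have hτ0 : (0 : ℝ) < τ.val := by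
      have : 0 < τ.val := by omega
      exact_mod_cast this
    have key : (sampleSize n : ℝ) / (τ.val * n) - sampleSize n / ((τ.val + 1) * n) ≤
        p * (sampleSize n / (τ.val * n)) := by
      have e1 : (sampleSize n : ℝ) / (τ.val * n) - sampleSize n / ((τ.val + 1) * n) =
          sampleSize n / (τ.val * n) * (1 / (τ.val + 1)) := by
        field_simp
        ring
      rw [e1, mul_comm p]
      refine mul_le_mul_of_nonneg_left ?_ (by positivity)
      push_cast at hp
      rwa [div_le_iff₀ (by linarith)]
    linarith

theorem simpleSecretary_wait (hn : 3 ≤ n) (I : Instance n) {c : Fin n}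
    (hc : I.IsReceiverBest c) {T : (simpleSecretary n hn).Outcome → Fin n}
    (hT : ∀ π (b : Bool) t, T (π, b) = t ↔ ClassicHires (sampleSize n) (I.value b) π t) (r : Fin n) :
    (simpleSecretary n hn).prob (fun o => r < T o ∧ o.1 r = c) ≤
      (simpleSecretary n hn).prob (fun o => r < T o ∧ o.1 (T o) = c) := by
  have hs := sampleSize_pos hn
  have hsn := sampleSize_lt hn
  have hp1 := exp_one_le_of_three_le hn
  have hn0 : (0 : ℝ) < n := by
    have : 0 < n := by omega
    exact_mod_cast this
  have hp0 : 0 ≤ Real.exp 1 / n := by positivity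
  rcases Nat.lt_or_ge (r.val + 1) n with hrn | hrn
  swap
  · rw [Mechanism.prob_eq_zero]
    · exact Mechanism.prob_nonneg _ _
    · rintro o ⟨h, -⟩
      have := (T o).isLt
      have : r.val < (T o).val := h
      omega
  obtain ⟨m, rfl⟩ : ∃ m, n = m + 1 := ⟨n - 1, by omega⟩
  have hright : ∀ k : ℕ, sampleSize (m + 1) ≤ k → r.val < k →
      Real.exp 1 / (m + 1 : ℕ) *
          (∑ j ∈ Finset.Ico k (m + 1), (sampleSize (m + 1) : ℝ) / (j * (m + 1 : ℕ))) +
        (1 - Real.exp 1 / (m + 1 : ℕ)) * (sampleSize (m + 1) / (m * (m + 1 : ℕ))) ≤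
      (simpleSecretary (m + 1) hn).prob (fun o => r < T o ∧ o.1 (T o) = c) := by
    intro k hk hrk
    rw [simpleSecretary_prob]
    refine add_le_add (mul_le_mul_of_nonneg_left ?_ hp0)
      (mul_le_mul_of_nonneg_left ?_ (sub_nonneg.2 hp1))
    · rw [← permProb_classicHires_best_from hs hk (I.value_injective true) hc]
      refine permProb_mono ?_
      rintro π ⟨t, ht, hkt, hπ⟩
      rw [(hT π true t).2 ht]
      exact ⟨Fin.lt_def.2 (by omega), hπ⟩
    -- Under the `ξ` seed only hiring in the last round is counted, since there the probability of
    -- `c` is known without relating `ξ` to `ρ`.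
    · have := permProb_classicHires_last hs (I.value_injective false) c (t := Fin.last m)
        (by rw [Fin.val_last]; omega) (by simp)
      rw [Fin.val_last] at this
      rw [← this]
      refine permProb_mono fun π h => ?_
      rw [(hT π false _).2 h.1]
      exact ⟨Fin.lt_def.2 (by rw [Fin.val_last]; omega), h.2⟩
  have hscale : ∀ k : ℕ, ∑ j ∈ Finset.Ico k (m + 1),
      (sampleSize (m + 1) : ℝ) / (j * (m + 1 : ℕ)) =
        sampleSize (m + 1) / (m + 1 : ℕ) * ∑ j ∈ Finset.Ico k (m + 1), 1 / (j : ℝ) := by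
    intro k
    rw [Finset.mul_sum]
    refine Finset.sum_congr rfl fun j _ => ?_
    rw [div_mul_div_comm, mul_one, mul_comm (j : ℝ)]
  have hq : (0 : ℝ) < sampleSize (m + 1) := by exact_mod_cast hs
  rcases lt_or_ge r.val (sampleSize (m + 1)) with hr | hr
  -- During the sample phase the signals carry no information, and the trivial bound `1 / n` for the
  -- left side suffices.
  · refine le_trans ?_ (hright _ le_rfl hr)
    have hleft : (simpleSecretary (m + 1) hn).prob (fun o => r < T o ∧ o.1 r = c) ≤
        1 / (m + 1 : ℕ) := by
      refine ((simpleSecretary (m + 1) hn).prob_mono fun o h => h.2).trans ?_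
      rw [simpleSecretary_prob]
      simp only [permProb_apply_eq]
      linarith
    refine hleft.trans ?_
    have hb := wait_bound (p := Real.exp 1 / (m + 1 : ℕ)) (m := m) hs
      (fun j hj => one_le_exp_div_mul hn hj) (by omega)
    -- Split `1 / n = p / n + (1 - p) / n`: the term `j = s` pays for `p / n`, and `wait_bound` with
    -- `k = s` for the rest.
    rw [hscale, Finset.sum_eq_sum_Ico_succ_bot (by omega)]
    set p := Real.exp 1 / (m + 1 : ℕ)
    set s : ℝ := (sampleSize (m + 1) : ℝ)
    set S := ∑ j ∈ Finset.Ico (sampleSize (m + 1) + 1) (m + 1), 1 / (j : ℝ)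
    have h2 := mul_le_mul_of_nonneg_left hb (by positivity : 0 ≤ s / (m + 1 : ℕ))
    have e1 : s / (m + 1 : ℕ) * ((1 - p) / s) = (1 - p) * (1 / (m + 1 : ℕ)) := by
      field_simp
    have e2 : p * (s / (m + 1 : ℕ) * (1 / s + S)) =
        p * (1 / (m + 1 : ℕ)) + s / (m + 1 : ℕ) * (p * S) := by
      field_simp
    have e3 : s / (m + 1 : ℕ) * ((1 - p) / m) = (1 - p) * (s / (m * (m + 1 : ℕ))) := by
      rw [div_mul_div_comm, mul_comm ((m + 1 : ℕ) : ℝ), mul_comm s, mul_div_assoc]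
    rw [e2, ← e3]
    rw [mul_add, e1] at h2
    linarith
  · refine le_trans ?_ (hright (r.val + 1) (by omega) (by omega))
    have hr0 : 0 < r.val := by omega
    have hleft : (simpleSecretary (m + 1) hn).prob (fun o => r < T o ∧ o.1 r = c) ≤
        (1 - Real.exp 1 / (m + 1 : ℕ)) * (sampleSize (m + 1) / (r.val * (m + 1 : ℕ))) := by
      -- Under the `ρ` seed, `c` arriving in round `r ≥ s` is a record, so `HIRE` would come no
      -- later than `r`. Only the `ξ` seed contributes.
      rw [simpleSecretary_prob, permProb_eq_zero, mul_zero, zero_add]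
      · refine mul_le_mul_of_nonneg_left ?_ (sub_nonneg.2 hp1)
        rw [← permProb_noRecord hs hr (I.value_injective false) le_rfl c]
        refine permProb_mono fun π h => ⟨h.2, ?_⟩
        have hCH := (hT π false _).1 rfl
        exact (forall_not_qualifies_iff (I.value_injective false)).1
          fun q hq => hCH.2 q (hq.trans h.1)
      · rintro π ⟨hlt, hπ⟩
        have hCH := (hT π true _).1 rfl
        refine hCH.2 r hlt (qualifies_comp_iff.2 (Or.inl ⟨hr, fun i hi => ?_⟩))
        refine lt_of_le_of_ne ?_ fun he => hi.ne (π.injective (I.value_injective true he))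
        have hπ : π r = c := hπ
        rw [hπ]
        exact hc _
    refine hleft.trans ?_
    have hb := wait_bound (p := Real.exp 1 / (m + 1 : ℕ)) (m := m) hr0
      (fun j hj => one_le_exp_div_mul hn (by omega)) (by omega)
    rw [hscale]
    have h2 := mul_le_mul_of_nonneg_left hb
      (by positivity : 0 ≤ (sampleSize (m + 1) : ℝ) / (m + 1 : ℕ))
    refine le_trans (le_of_eq ?_) (h2.trans (le_of_eq ?_))
    · rw [div_mul_div_comm, mul_comm ((m + 1 : ℕ) : ℝ), mul_comm (sampleSize (m + 1) : ℝ),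
        mul_div_assoc]
    · rw [mul_add, mul_left_comm]
      congr 1
      rw [div_mul_div_comm, mul_comm ((m + 1 : ℕ) : ℝ), mul_comm (sampleSize (m + 1) : ℝ),
        mul_div_assoc]

theorem simpleSecretary_persuasive (hn : 3 ≤ n) : (simpleSecretary n hn).Persuasive := by
  intro I t h hnot _ d
  obtain ⟨T, hsig, hT⟩ := exists_hireRound hn I
  have : Nonempty (Fin n) := ⟨t⟩
  obtain ⟨c, hc⟩ := Finite.exists_max I.ρ
  refine Mechanism.condProb_receiverSuccess_le _ I (c := c) (fun i => ⟨fun hi => ?_, ?_⟩) T hsig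
    (fun τ r hr => simpleSecretary_hire hn I hc hT hr) (simpleSecretary_wait hn I hc hT) t h hnot d
  · exact I.ρ_injective (le_antisymm (hc i) (hi c))
  · rintro rfl
    exact hc

/-! ### Asymptotics of the sender's success. -/

/-- The success probability of the classic algorithm with sample size `⌊n / e⌋`. -/
noncomputable def classicSuccess (n : ℕ) : ℝ :=
  ∑ j ∈ Finset.Ico (sampleSize n) n, (sampleSize n : ℝ) / (j * n)

/-- In this form the limit can be read off: both differences of harmonic number and logarithm tend
to the Euler–Mascheroni constant and cancel, and `-log (s / n)` tends to `1`. -/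
theorem classicSuccess_eq (hn : 3 ≤ n) :
    classicSuccess n = sampleSize n / n *
      (((harmonic n : ℝ) - Real.log n) - ((harmonic (sampleSize n) : ℝ) - Real.log (sampleSize n)) +
        (1 / sampleSize n - 1 / n) - Real.log (sampleSize n / n)) := by
  have hs := sampleSize_pos hn
  have hn0 : (n : ℝ) ≠ 0 := by
    have : 0 < n := by omega
    positivity
  have hs0 : (sampleSize n : ℝ) ≠ 0 := by positivity
  -- The sum in `classicSuccess` stops at `n - 1`, so the top term of each harmonic number is
  -- removed.
  have hH : ∀ k : ℕ, (harmonic (k + 1) : ℝ) - 1 / (k + 1 : ℕ) =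
      ∑ j ∈ Finset.range k, 1 / ((j + 1 : ℕ) : ℝ) := by
    intro k
    rw [harmonic_succ, harmonic]
    push_cast
    simp
  have hsum : ∑ j ∈ Finset.Ico (sampleSize n) n, 1 / (j : ℝ) =
      ((harmonic n : ℝ) - 1 / n) - (harmonic (sampleSize n) - 1 / sampleSize n) := by
    obtain ⟨m, hm⟩ : ∃ m, n = m + 1 := ⟨n - 1, by omega⟩
    obtain ⟨k, hk⟩ : ∃ k, sampleSize n = k + 1 := ⟨sampleSize n - 1, by omega⟩
    have hlt := sampleSize_lt hn
    rw [hk, hm, hH, hH, ← Finset.sum_Ico_add' (fun j : ℕ => 1 / (j : ℝ)),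
      Finset.sum_Ico_eq_sub _ (by omega)]
  have hscale : classicSuccess n =
      sampleSize n / n * ∑ j ∈ Finset.Ico (sampleSize n) n, 1 / (j : ℝ) := by
    rw [classicSuccess, Finset.mul_sum]
    refine Finset.sum_congr rfl fun j _ => ?_
    rw [div_mul_div_comm, mul_one, mul_comm (j : ℝ)]
  rw [hscale, hsum, Real.log_div hs0 hn0]
  ring

theorem tendsto_sampleSize : Tendsto sampleSize atTop atTop :=
  tendsto_nat_floor_atTop.comp
    (tendsto_natCast_atTop_atTop.atTop_div_const (Real.exp_pos 1))

theorem tendsto_sampleSize_div :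
    Tendsto (fun n : ℕ => (sampleSize n : ℝ) / n) atTop (𝓝 (1 / Real.exp 1)) := by
  have h := (tendsto_nat_floor_mul_div_atTop (R := ℝ)
    (by positivity : 0 ≤ 1 / Real.exp 1)).comp tendsto_natCast_atTop_atTop
  refine h.congr fun n => ?_
  simp only [Function.comp_apply, sampleSize]
  rw [one_div_mul_eq_div]

theorem tendsto_classicSuccess : Tendsto classicSuccess atTop (𝓝 (1 / Real.exp 1)) := by
  have hlog : Tendsto (fun n : ℕ => Real.log ((sampleSize n : ℝ) / n)) atTop (𝓝 (-1)) := by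
    have h := (Real.continuousAt_log (by positivity : (1 / Real.exp 1) ≠ 0)).tendsto.comp
      tendsto_sampleSize_div
    simpa [Function.comp_def] using h
  have hH := Real.tendsto_harmonic_sub_log
  have hinv := tendsto_one_div_atTop_nhds_zero_nat (𝕜 := ℝ)
  have h := tendsto_sampleSize_div.mul
    (((hH.sub (hH.comp tendsto_sampleSize)).add
      ((hinv.comp tendsto_sampleSize).sub hinv)).sub hlog)
  have hlim : 1 / Real.exp 1 * (Real.eulerMascheroniConstant - Real.eulerMascheroniConstant +
      (0 - 0) - -1) = 1 / Real.exp 1 := by ring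
  rw [hlim] at h
  refine h.congr' ?_
  filter_upwards [eventually_ge_atTop 3] with n hn
  exact (classicSuccess_eq hn).symm

/-- Here `a` is the success probability under the `ρ` seed. It depends on the instance, but its
weight `e / n` vanishes. -/
theorem simpleSecretary_senderSuccess (hn : 3 ≤ n) (I : Instance n) :
    ∃ a, 0 ≤ a ∧ a ≤ 1 ∧ (simpleSecretary n hn).senderSuccess I =
      Real.exp 1 / n * a + (1 - Real.exp 1 / n) * classicSuccess n := by
  obtain ⟨T, hsig, hT⟩ := exists_hireRound hn I
  have : Nonempty (Fin n) := ⟨⟨0, by omega⟩⟩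
  obtain ⟨c, hc⟩ := Finite.exists_max I.ξ
  have hbest : ∀ i, I.IsSenderBest i ↔ i = c := by
    refine fun i => ⟨fun hi => I.ξ_injective (le_antisymm (hc i) (hi c)), ?_⟩
    rintro rfl
    exact hc
  unfold Mechanism.senderSuccess
  simp only [hsig, hiresAt_obedient_singleHire (Nat.zero_le _), exists_eq_left, hbest]
  refine ⟨permProb fun π => π (T (π, true)) = c, permProb_nonneg _, permProb_le_one _,
    (simpleSecretary_prob hn _).trans ?_⟩
  congr 2
  rw [classicSuccess, ← permProb_classicHires_best_from (sampleSize_pos hn) le_rfl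
    (I.value_injective false) hc]
  refine permProb_congr fun π => ⟨fun h => ?_, ?_⟩
  · have hCH := (hT π false _).1 rfl
    exact ⟨_, hCH, hCH.le (sampleSize_lt hn), h⟩
  · rintro ⟨t, ht, -, hπ⟩
    rw [(hT π false t).2 ht]
    exact hπ

theorem Mechanism.senderSuccess_mul_le_senderUtility (M : Mechanism n) (I : Instance n) :
    M.senderSuccess I * I.ξMax ≤ M.senderUtility I := by
  unfold Mechanism.senderSuccess Mechanism.prob Mechanism.senderUtility
  have hmul : ∀ f : M.Outcome → ℝ, M.expect f * I.ξMax = M.expect fun o => f o * I.ξMax := by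
    intro f
    unfold Mechanism.expect
    rw [Finset.sum_mul]
    exact Finset.sum_congr rfl fun o _ => mul_assoc _ _ _
  rw [hmul]
  refine M.expect_mono fun o => ?_
  have hnn : ∀ r ∈ Finset.univ, 0 ≤
      @ite ℝ (HiresAt (obedient n) (M.signals I o) 0 r) (Classical.propDecidable _)
        (I.ξ (o.1 r)) 0 := by
    intro r _
    split_ifs
    · exact I.ξ_nonneg _
    · exact le_rfl
  split_ifs with h
  · obtain ⟨r, hr, hbest⟩ := h
    refine le_trans ?_ (Finset.single_le_sum hnn (Finset.mem_univ r))
    have : Nonempty (Fin n) := ⟨r⟩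
    rw [if_pos hr, one_mul]
    exact ciSup_le hbest
  · rw [zero_mul]
    exact Finset.sum_nonneg hnn

end SimpleSecretary

end OnlinePersuasion

theorem mainTheorem9 :
    (∀ (n : ℕ) (hn : 3 ≤ n), (OnlinePersuasion.simpleSecretary n hn).Persuasive) ∧
    ∃ ε : ℕ → ℝ, Tendsto ε atTop (𝓝 0) ∧
      ∀ (n : ℕ) (hn : 3 ≤ n) (I : OnlinePersuasion.Instance n),
        |(OnlinePersuasion.simpleSecretary n hn).senderSuccess I - 1 / Real.exp 1| ≤ ε n ∧
        (1 / Real.exp 1 - ε n) * I.ξMax ≤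
          (OnlinePersuasion.simpleSecretary n hn).senderUtility I := by
  refine ⟨fun n hn => OnlinePersuasion.simpleSecretary_persuasive hn,
    -- The second summand bounds `e / n * |a - classicSuccess n|` for every `a` in `[0, 1]`, hence
    -- for all instances at once.
    fun n => |OnlinePersuasion.classicSuccess n - 1 / Real.exp 1| +
      Real.exp 1 / n * (1 + |OnlinePersuasion.classicSuccess n|), ?_, ?_⟩
  · have h1 := OnlinePersuasion.tendsto_classicSuccess
    have h2 : Tendsto (fun n : ℕ => Real.exp 1 / n) atTop (𝓝 0) :=
      tendsto_const_div_atTop_nhds_zero_nat _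
    have h3 := (h1.sub_const (1 / Real.exp 1)).abs.add (h2.mul (h1.abs.const_add 1))
    simpa using h3
  · intro n hn I
    have habs : |(OnlinePersuasion.simpleSecretary n hn).senderSuccess I - 1 / Real.exp 1| ≤
        |OnlinePersuasion.classicSuccess n - 1 / Real.exp 1| +
          Real.exp 1 / n * (1 + |OnlinePersuasion.classicSuccess n|) := by
      obtain ⟨a, ha0, ha1, ha⟩ := OnlinePersuasion.simpleSecretary_senderSuccess hn I
      have hp : 0 ≤ Real.exp 1 / n := by positivity
      have hsplit : (OnlinePersuasion.simpleSecretary n hn).senderSuccess I - 1 / Real.exp 1 =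
          (OnlinePersuasion.classicSuccess n - 1 / Real.exp 1) +
            Real.exp 1 / n * (a - OnlinePersuasion.classicSuccess n) := by
        rw [ha]
        ring
      rw [hsplit]
      refine (abs_add_le _ _).trans (add_le_add le_rfl ?_)
      rw [abs_mul, abs_of_nonneg hp]
      refine mul_le_mul_of_nonneg_left ((abs_sub _ _).trans ?_) hp
      rw [abs_of_nonneg ha0]
      linarith
    refine ⟨habs, le_trans ?_
      (OnlinePersuasion.Mechanism.senderSuccess_mul_le_senderUtility _ I)⟩
    refine mul_le_mul_of_nonneg_right ?_ (Real.iSup_nonneg I.ξ_nonneg)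
    linarith [(abs_le.1 habs).1]
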